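/- Let $k$ be a field and let $a,d$ be positive integers with $2\le d<a$ and $\gcd(a,d)=1$. Write $a=dq+r$ with integers $q$ and $r$ such that $1\le r\le d-1$. Let $H=\langle a,a+1,a+d\rangle\subseteq\mathbb{N}$ be the numerical semigroup generated by $a,a+1,a+d$, let $R=k[[H]]=k[[t^{a},t^{a+1},t^{a+d}]]\subseteq k[[t]]$ be its numerical semigroup ring, that is, the local ring of all formal power series $\sum_n c_nt^n$ over $k$ with $c_n=0$ for all $n\notin H$, and let $\mathfrak m$ be the maximal ideal of $R$. If $q+r\ge d-2$, then the associated graded ring $\mathrm{gr}_{\mathfrak m}(R)=\bigoplus_{n\ge 0}\mathfrak m^n/\mathfrak m^{n+1}$ is Cohen–Macaulay. -/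

import Mathlib

open scoped DirectSum PowerSeries

/-! ### Numerical semigroup rings -/

/-- The semigroup ring `k[[H]] ⊆ k[[t]]` of an additive submonoid `H ⊆ ℕ`: all formal power series
`∑ cₙ tⁿ` with `cₙ = 0` for every `n ∉ H`. -/
def semigroupRing (k : Type*) [Field k] (H : AddSubmonoid ℕ) : Subalgebra k k⟦X⟧ where
  carrier := {f | ∀ n, n ∉ H → PowerSeries.coeff n f = 0}
  mul_mem' := by
    intro f g hf hg n hn
    rw [PowerSeries.coeff_mul]
    refine Finset.sum_eq_zero fun p hp => ?_
    rw [Finset.HasAntidiagonal.mem_antidiagonal] at hp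
    by_cases h1 : p.1 ∈ H
    · by_cases h2 : p.2 ∈ H
      · exact absurd (hp ▸ H.add_mem h1 h2) hn
      · rw [hg _ h2, mul_zero]
    · rw [hf _ h1, zero_mul]
  add_mem' := by
    intro f g hf hg n hn
    rw [map_add, hf n hn, hg n hn, add_zero]
  algebraMap_mem' := by
    intro c n hn
    have h0 : n ≠ 0 := fun h => hn (h ▸ H.zero_mem)
    rw [PowerSeries.algebraMap_apply, PowerSeries.coeff_C, if_neg h0]

theorem mem_semigroupRing {k : Type*} [Field k] {H : AddSubmonoid ℕ} {f : k⟦X⟧} :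
    f ∈ semigroupRing k H ↔ ∀ n, n ∉ H → PowerSeries.coeff n f = 0 := Iff.rfl

/-- The semigroup ring contains the inverses of its elements with nonzero constant term. -/
theorem inv_mem_semigroupRing {k : Type*} [Field k] {H : AddSubmonoid ℕ} {f : k⟦X⟧}
    (hf : f ∈ semigroupRing k H) : f⁻¹ ∈ semigroupRing k H := by
  intro n
  induction n using Nat.strong_induction_on with
  | _ n ih =>
    intro hn
    have h0 : n ≠ 0 := fun h => hn (h ▸ H.zero_mem)
    rw [PowerSeries.coeff_inv, if_neg h0]
    rw [Finset.sum_eq_zero, mul_zero]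
    intro p hp
    rw [Finset.HasAntidiagonal.mem_antidiagonal] at hp
    split_ifs with hlt
    · by_cases h1 : p.1 ∈ H
      · by_cases h2 : p.2 ∈ H
        · exact absurd (hp ▸ H.add_mem h1 h2) hn
        · rw [ih _ hlt h2, mul_zero]
      · rw [hf _ h1, zero_mul]
    · rfl

theorem isUnit_semigroupRing_iff {k : Type*} [Field k] {H : AddSubmonoid ℕ}
    (f : semigroupRing k H) :
    IsUnit f ↔ PowerSeries.constantCoeff (f : k⟦X⟧) ≠ 0 := by
  constructor
  · intro h
    exact ((h.map (semigroupRing k H).val).map (PowerSeries.constantCoeff (R := k))).ne_zero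
  · intro h
    exact IsUnit.of_mul_eq_one ⟨(f : k⟦X⟧)⁻¹, inv_mem_semigroupRing f.2⟩
      (Subtype.ext (PowerSeries.mul_inv_cancel _ h))

/-- The semigroup ring is a local ring; its maximal ideal consists of the series in it whose
constant term vanishes. -/
instance semigroupRing.instIsLocalRing {k : Type*} [Field k] {H : AddSubmonoid ℕ} :
    IsLocalRing (semigroupRing k H) :=
  IsLocalRing.of_nonunits_add (by
    intro f g hf hg
    rw [mem_nonunits_iff, isUnit_semigroupRing_iff, not_not] at hf hg ⊢
    rw [Subalgebra.coe_add, map_add, hf, hg, add_zero])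

/-! ### The associated graded ring of an ideal -/

/-- The `n`-th graded piece `Iⁿ / Iⁿ⁺¹`. -/
def GrPiece {R : Type*} [CommRing R] (I : Ideal R) (n : ℕ) : Type _ :=
  ↥(I ^ n) ⧸ Submodule.comap (I ^ n).subtype (I ^ (n + 1))

namespace GrPiece

variable {R : Type*} [CommRing R] {I : Ideal R}

instance instAddCommGroup {n : ℕ} : AddCommGroup (GrPiece I n) :=
  inferInstanceAs (AddCommGroup (↥(I ^ n) ⧸ Submodule.comap (I ^ n).subtype (I ^ (n + 1))))

instance instModule {n : ℕ} : Module R (GrPiece I n) :=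
  inferInstanceAs (Module R (↥(I ^ n) ⧸ Submodule.comap (I ^ n).subtype (I ^ (n + 1))))

/-- The class in `Iⁿ / Iⁿ⁺¹` of an element of `Iⁿ`. -/
def mk (n : ℕ) (x : R) (hx : x ∈ I ^ n) : GrPiece I n :=
  Submodule.Quotient.mk ⟨x, hx⟩

theorem exists_mk {n : ℕ} (a : GrPiece I n) : ∃ x hx, a = mk n x hx := by
  obtain ⟨⟨x, hx⟩, rfl⟩ := Submodule.Quotient.mk_surjective _ a
  exact ⟨x, hx, rfl⟩

theorem mk_eq_mk_iff {n : ℕ} {x y : R} {hx : x ∈ I ^ n} {hy : y ∈ I ^ n} :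
    mk n x hx = mk n y hy ↔ x - y ∈ I ^ (n + 1) :=
  Submodule.Quotient.eq _

theorem sigma_mk_eq {m n : ℕ} {x y : R} (hx : x ∈ I ^ m) (hy : y ∈ I ^ n) (h : m = n)
    (hxy : x = y) :
    (GradedMonoid.mk m (mk m x hx) : GradedMonoid (GrPiece I)) = GradedMonoid.mk n (mk n y hy) := by
  subst h; subst hxy; rfl

theorem mul_mem_pow_add {m n : ℕ} {x y : R} (hx : x ∈ I ^ m) (hy : y ∈ I ^ n) :
    x * y ∈ I ^ (m + n) := pow_add I m n ▸ Ideal.mul_mem_mul hx hy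

/-- The multiplication `Iᵐ / Iᵐ⁺¹ × Iⁿ / Iⁿ⁺¹ → Iᵐ⁺ⁿ / Iᵐ⁺ⁿ⁺¹` induced by that of `R`. -/
def mul {m n : ℕ} (a : GrPiece I m) (b : GrPiece I n) : GrPiece I (m + n) :=
  Quotient.liftOn₂' a b
    (fun x y => mk (m + n) (x.1 * y.1) (mul_mem_pow_add x.2 y.2)) (by
      intro x y x' y' hx hy
      rw [Submodule.quotientRel_def, Submodule.mem_comap] at hx hy
      rw [mk_eq_mk_iff]
      have h1 : (x.1 - x'.1) * y.1 ∈ I ^ (m + n + 1) := by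
        have := mul_mem_pow_add hx y.2
        rwa [show m + 1 + n = m + n + 1 by omega] at this
      have h2 : x'.1 * (y.1 - y'.1) ∈ I ^ (m + n + 1) :=
        mul_mem_pow_add (n := n + 1) x'.2 hy
      have h3 := Ideal.add_mem _ h1 h2
      rwa [show (x.1 - x'.1) * y.1 + x'.1 * (y.1 - y'.1) = x.1 * y.1 - x'.1 * y'.1 by ring] at h3)

theorem mul_mk_mk {m n : ℕ} {x y : R} (hx : x ∈ I ^ m) (hy : y ∈ I ^ n) :
    mul (mk m x hx) (mk n y hy) = mk (m + n) (x * y) (mul_mem_pow_add hx hy) := rfl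

theorem mk_add_mk {n : ℕ} {x y : R} (hx : x ∈ I ^ n) (hy : y ∈ I ^ n) :
    mk n x hx + mk n y hy = mk n (x + y) (Ideal.add_mem _ hx hy) := rfl

theorem zero_eq_mk {n : ℕ} : (0 : GrPiece I n) = mk n 0 (Ideal.zero_mem _) := rfl

instance instGOne : GradedMonoid.GOne (GrPiece I) where
  one := mk 0 1 (by simp)

instance instGMul : GradedMonoid.GMul (GrPiece I) where
  mul := mul

instance instGCommRing : DirectSum.GCommRing (GrPiece I) where
  mul := mul
  one := mk 0 1 (by simp)
  mul_zero a := by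
    obtain ⟨x, hx, rfl⟩ := exists_mk a
    simp only [zero_eq_mk, mul_mk_mk, mul_zero]
  zero_mul a := by
    obtain ⟨x, hx, rfl⟩ := exists_mk a
    simp only [zero_eq_mk, mul_mk_mk, zero_mul]
  mul_add a b c := by
    obtain ⟨x, hx, rfl⟩ := exists_mk a
    obtain ⟨y, hy, rfl⟩ := exists_mk b
    obtain ⟨z, hz, rfl⟩ := exists_mk c
    simp only [mk_add_mk, mul_mk_mk, mul_add]
  add_mul a b c := by
    obtain ⟨x, hx, rfl⟩ := exists_mk a
    obtain ⟨y, hy, rfl⟩ := exists_mk b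
    obtain ⟨z, hz, rfl⟩ := exists_mk c
    simp only [mk_add_mk, mul_mk_mk, add_mul]
  one_mul := by
    rintro ⟨n, a⟩
    obtain ⟨x, hx, rfl⟩ := exists_mk a
    exact sigma_mk_eq _ _ (zero_add n) (one_mul x)
  mul_one := by
    rintro ⟨n, a⟩
    obtain ⟨x, hx, rfl⟩ := exists_mk a
    exact sigma_mk_eq _ _ (add_zero n) (mul_one x)
  mul_assoc := by
    rintro ⟨l, a⟩ ⟨m, b⟩ ⟨n, c⟩
    obtain ⟨x, hx, rfl⟩ := exists_mk a
    obtain ⟨y, hy, rfl⟩ := exists_mk b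
    obtain ⟨z, hz, rfl⟩ := exists_mk c
    exact sigma_mk_eq _ _ (add_assoc l m n) (mul_assoc x y z)
  mul_comm := by
    rintro ⟨m, a⟩ ⟨n, b⟩
    obtain ⟨x, hx, rfl⟩ := exists_mk a
    obtain ⟨y, hy, rfl⟩ := exists_mk b
    exact sigma_mk_eq _ _ (add_comm m n) (mul_comm x y)
  natCast n := mk 0 (n : R) (by simp)
  natCast_zero := by simp only [Nat.cast_zero]; rfl
  natCast_succ n := by simp only [Nat.cast_succ]; rfl
  intCast n := mk 0 (n : R) (by simp)
  intCast_ofNat n := by simp only [Int.cast_natCast]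
  intCast_negSucc_ofNat n := by simp only [Int.cast_negSucc]; rfl

end GrPiece

/-- The associated graded ring `gr_I(R) = ⨁ₙ Iⁿ / Iⁿ⁺¹`, a commutative ring whose multiplication
is induced by that of `R`. -/
abbrev AssociatedGradedRing {R : Type*} [CommRing R] (I : Ideal R) : Type _ :=
  ⨁ n, GrPiece I n

noncomputable instance AssociatedGradedRing.instCommRing {R : Type*} [CommRing R] (I : Ideal R) :
    CommRing (AssociatedGradedRing I) :=
  DirectSum.commRing (GrPiece I)

/-! ### Cohen–Macaulay rings -/

/-- The depth of a local ring: the supremum of the lengths of the regular sequences contained in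
its maximal ideal. -/
noncomputable def localRingDepth (A : Type*) [CommRing A] [IsLocalRing A] : ℕ∞ :=
  sSup {n : ℕ∞ | ∃ rs : List A, (∀ x ∈ rs, x ∈ IsLocalRing.maximalIdeal A) ∧
    RingTheory.Sequence.IsRegular A rs ∧ (rs.length : ℕ∞) = n}

/-- A Noetherian ring is Cohen–Macaulay if for each of its localizations at prime ideals the depth
equals the Krull dimension. -/
def IsCohenMacaulayRing (A : Type*) [CommRing A] : Prop :=
  IsNoetherianRing A ∧ ∀ (p : Ideal A) [p.IsPrime],
    (localRingDepth (Localization.AtPrime p) : WithBot ℕ∞) = ringKrullDim (Localization.AtPrime p)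

/-!
The associated graded ring `G` of the semigroup ring is finite and torsion-free over a polynomial
ring `k[x]`, where `x` is the initial form of `t ^ a`. Such a ring is Cohen–Macaulay
(`isCohenMacaulayRing_of_finite_of_torsionFree`).

Finiteness: `G` is generated over `k` by the initial forms of `t ^ a`, `t ^ (a + 1)` and
`t ^ (a + d)`, and the last two are nilpotent, because `(t ^ h) ^ a = (t ^ a) ^ h` lies in a power of
the maximal ideal with exponent `h > a`.

Torsion-freeness: a nonzero polynomial in a homogeneous nonzerodivisor of degree one is again a
nonzerodivisor (`eval₂_mem_nonZeroDivisors_of_degree_one`), so it is enough that `x` is a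
nonzerodivisor. The powers of the maximal ideal are described by the orders of the exponents, the
order of `s` being the largest number of generators with sum `s` (`mem_maximalIdeal_pow_iff`). Hence
`x` is a nonzerodivisor if and only if adding `a` to an element of the semigroup raises its order by
exactly one.

A number is a sum of `N` generators if and only if it equals `N * a + j` with `c j ≤ N`, where
`c j = j / d + j % d` is the least value of `y + z` with `y + d * z = j`. Writing `a = d * q + r`, the
assumption `d - 2 ≤ q + r` says that passing from `j` to `j + a` lowers `c` by at most one
(`div_add_mod_le_add_one`). Suppose that `a + s = N * a + j` with `c j ≤ N`, and that
`s = N' * a + j'` with `c j' ≤ N'` and `N' < N - 1`. Then `j' = j + (N - 1 - N') * a`, so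
`c j ≤ c j' + (N - 1 - N') ≤ N - 1`, and `s = (N - 1) * a + j` is a sum of `N - 1` generators
(`mem_orderAtLeast_succ_of_add_mem`).
-/

/-! ### A criterion for the Cohen–Macaulay property -/

theorem le_localRingDepth {A : Type*} [CommRing A] [IsLocalRing A] {rs : List A}
    (hmem : ∀ x ∈ rs, x ∈ IsLocalRing.maximalIdeal A)
    (hreg : RingTheory.Sequence.IsRegular A rs) : (rs.length : ℕ∞) ≤ localRingDepth A :=
  le_sSup ⟨rs, hmem, hreg, rfl⟩

theorem localRingDepth_le_ringKrullDim (A : Type*) [CommRing A] [IsLocalRing A]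
    [IsNoetherianRing A] : (localRingDepth A : WithBot ℕ∞) ≤ ringKrullDim A := by
  have hA : (0 : WithBot ℕ∞) ≤ ringKrullDim A := ringKrullDim_nonneg_of_nontrivial
  obtain ⟨d, hd⟩ := WithBot.ne_bot_iff_exists.mp
    (ne_of_gt (lt_of_lt_of_le (WithBot.bot_lt_coe (0 : ℕ∞)) hA))
  rw [← hd, WithBot.coe_le_coe]
  refine sSup_le ?_
  rintro _ ⟨rs, -, hreg, rfl⟩
  rw [← WithBot.coe_le_coe, hd, ← ringKrullDim_add_length_eq_ringKrullDim_of_isRegular rs hreg]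
  have : Nontrivial (A ⧸ Ideal.ofList rs) := by
    refine Ideal.Quotient.nontrivial_iff.mpr fun h => hreg.top_ne_smul ?_
    rw [h, Ideal.smul_eq_mul, Ideal.mul_top]
  exact le_add_of_nonneg_left ringKrullDim_nonneg_of_nontrivial

/-- A finite torsion-free algebra over a Noetherian domain of dimension at most one is
Cohen–Macaulay: a prime lying over zero is minimal, and any other prime contains the image of a
nonzero element of the base, which is a nonzerodivisor. -/
theorem isCohenMacaulayRing_of_finite_of_torsionFree {A B : Type*} [CommRing A] [IsDomain A]
    [IsNoetherianRing A] [CommRing B] [Algebra A B] [Module.Finite A B]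
    (hdim : ringKrullDim A ≤ 1)
    (htf : ∀ f : A, f ≠ 0 → algebraMap A B f ∈ nonZeroDivisors B) : IsCohenMacaulayRing B := by
  have hN : IsNoetherianRing B := IsNoetherianRing.of_finite A B
  refine ⟨hN, fun p hp => ?_⟩
  have hNp : IsNoetherianRing (Localization.AtPrime p) :=
    IsLocalization.isNoetherianRing p.primeCompl _ hN
  refine le_antisymm (localRingDepth_le_ringKrullDim _) ?_
  have hht := IsLocalization.AtPrime.ringKrullDim_eq_height p (Localization.AtPrime p)
  by_cases hpA : p.comap (algebraMap A B) = ⊥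
  · have : p.height = 0 := by
      rw [Ideal.height_eq_zero_iff]
      refine ⟨⟨hp, bot_le⟩, fun P hP hPp => ?_⟩
      by_contra hpP
      have := hP.1
      have hlt := Ideal.IsIntegral.comap_lt_comap (R := A) (lt_of_le_not_ge hPp hpP)
      exact not_lt_bot (hpA ▸ hlt)
    rw [hht, this]
    exact WithBot.coe_le_coe.mpr (zero_le)
  · obtain ⟨f, hfp, hf0⟩ := Submodule.exists_mem_ne_zero_of_ne_bot hpA
    have hle : ringKrullDim (Localization.AtPrime p) ≤ 1 := by
      refine hht.trans_le ((Ideal.height_le_ringKrullDim_of_ne_top hp.ne_top).trans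
        (le_trans ?_ hdim))
      refine Order.krullDim_le_of_strictMono (PrimeSpectrum.comap (algebraMap A B)) ?_
      intro P Q hPQ
      exact Ideal.IsIntegral.comap_lt_comap (R := A) hPQ
    refine hle.trans (WithBot.coe_le_coe.mpr ?_)
    set w := algebraMap B (Localization.AtPrime p) (algebraMap A B f)
    have hw : w ∈ nonZeroDivisors (Localization.AtPrime p) :=
      IsLocalization.nonZeroDivisors_le_comap p.primeCompl _ (htf f hf0)
    have hmem : ∀ x ∈ [w], x ∈ IsLocalRing.maximalIdeal (Localization.AtPrime p) := by
      intro x hx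
      rw [List.mem_singleton.mp hx]
      exact (IsLocalization.AtPrime.to_map_mem_maximal_iff _ p _).mpr hfp
    refine le_localRingDepth (rs := [w]) hmem ?_
    rw [IsLocalRing.isRegular_iff_isWeaklyRegular_of_subset_maximalIdeal hmem,
      RingTheory.Sequence.isWeaklyRegular_singleton_iff]
    exact Module.Flat.isSMulRegular_of_nonZeroDivisors hw

/-! ### Polynomials in a homogeneous element of degree one -/

section Graded

variable {A : ℕ → Type*} [∀ n, AddCommGroup (A n)] [DirectSum.GCommRing A]

/-- The ring homomorphism `⨁ Aₙ → (⨁ Aₙ)[T]` sending a homogeneous element `a` of degree `n` to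
`a Tⁿ`. -/
noncomputable def degreePolynomial : (⨁ n, A n) →+* Polynomial (⨁ n, A n) :=
  DirectSum.toSemiring
    (fun n => (Polynomial.monomial n).toAddMonoidHom.comp (DirectSum.of A n)) (by rfl)
    (fun a b => by
      simp [Polynomial.monomial_mul_monomial, DirectSum.of_mul_of])

theorem degreePolynomial_of (n : ℕ) (a : A n) :
    degreePolynomial (DirectSum.of A n a) = Polynomial.monomial n (DirectSum.of A n a) :=
  DirectSum.toSemiring_of _ _ _ n a

theorem degreePolynomial_injective :
    Function.Injective (degreePolynomial (A := A)) := by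
  have h : ((Polynomial.evalRingHom 1).comp (degreePolynomial (A := A))) = RingHom.id _ := by
    refine DirectSum.ringHom_ext fun n a => ?_
    simp [degreePolynomial_of]
  exact Function.LeftInverse.injective (g := Polynomial.evalRingHom 1)
    fun g => RingHom.congr_fun h g

/-- A nonzero polynomial over a field `k` mapping to degree zero, evaluated at a homogeneous
nonzerodivisor of degree one, is a nonzerodivisor: its nonzero homogeneous components are powers of
that element multiplied by units. -/
theorem eval₂_mem_nonZeroDivisors_of_degree_one {k : Type*} [Field k] (κ : k →+* A 0) {ξ : A 1}
    (hξ : DirectSum.of A 1 ξ ∈ nonZeroDivisors (⨁ n, A n)) {f : Polynomial k} (hf : f ≠ 0) :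
    f.eval₂ ((DirectSum.ofZeroRingHom A).comp κ) (DirectSum.of A 1 ξ) ∈
      nonZeroDivisors (⨁ n, A n) := by
  set x := DirectSum.of A 1 ξ
  set ι := (DirectSum.ofZeroRingHom A).comp κ
  have hx : degreePolynomial x = Polynomial.C x * Polynomial.X := by
    rw [degreePolynomial_of, Polynomial.C_mul_X_eq_monomial]
  have hι (c : k) : degreePolynomial (ι c) = Polynomial.C (ι c) := degreePolynomial_of 0 (κ c)
  have hcoeff (g : Polynomial k) (n : ℕ) :
      (degreePolynomial (g.eval₂ ι x)).coeff n = ι (g.coeff n) * x ^ n := by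
    induction g using Polynomial.induction_on' with
    | add p q hp hq => simp [Polynomial.eval₂_add, hp, hq, add_mul]
    | monomial m c =>
      rw [Polynomial.eval₂_monomial, map_mul, map_pow, hι, hx, mul_pow, ← Polynomial.C_pow,
        ← mul_assoc, ← Polynomial.C_mul, Polynomial.coeff_C_mul_X_pow, Polynomial.coeff_monomial]
      by_cases h : m = n
      · simp [h]
      · simp [h, Ne.symm h]
  refine mem_nonZeroDivisors_of_injective degreePolynomial_injective ?_
  refine Polynomial.mem_nonzeroDivisors_of_coeff_mem f.natDegree ?_
  rw [hcoeff]
  exact mul_mem ((IsUnit.mk0 _ (Polynomial.leadingCoeff_ne_zero.mpr hf)).map ι).mem_nonZeroDivisors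
    (pow_mem hξ _)

/-- A homogeneous element is a nonzerodivisor as soon as multiplication by it is injective on each
graded piece. -/
theorem of_mem_nonZeroDivisors {i : ℕ} {ξ : A i}
    (h : ∀ n (b : A n), GradedMonoid.GMul.mul ξ b = 0 → b = 0) :
    DirectSum.of A i ξ ∈ nonZeroDivisors (⨁ n, A n) := by
  have key (g : ⨁ n, A n) (n : ℕ) :
      (DirectSum.of A i ξ * g) (i + n) = GradedMonoid.GMul.mul ξ (g n) := by
    induction g using DirectSum.induction_on with
    | zero => simp [DirectSum.GNonUnitalNonAssocSemiring.mul_zero]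
    | of j b =>
      rw [DirectSum.of_mul_of]
      by_cases hj : n = j
      · subst hj
        rw [DirectSum.of_eq_same, DirectSum.of_eq_same]
      · rw [DirectSum.of_eq_of_ne _ _ _ (by omega), DirectSum.of_eq_of_ne _ _ _ hj,
          DirectSum.GNonUnitalNonAssocSemiring.mul_zero]
    | add p q hp hq =>
      rw [mul_add, DirectSum.add_apply, DirectSum.add_apply, hp, hq,
        DirectSum.GNonUnitalNonAssocSemiring.mul_add]
  rw [mem_nonZeroDivisors_iff_right]
  intro g hg
  refine DFinsupp.ext fun n => h n _ ?_
  rw [← key, mul_comm, hg]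
  rfl

end Graded

/-! ### Generators of the associated graded ring -/

section AssociatedGraded

variable {R : Type*} [CommRing R] {I : Ideal R}

/-- The class of `x ∈ Iⁿ` in the degree `n` part of the associated graded ring. -/
noncomputable def grClass (n : ℕ) (x : R) (hx : x ∈ I ^ n) : AssociatedGradedRing I :=
  DirectSum.of (GrPiece I) n (GrPiece.mk n x hx)

theorem grClass_mul {m n : ℕ} {x y : R} (hx : x ∈ I ^ m) (hy : y ∈ I ^ n) :
    grClass m x hx * grClass n y hy = grClass (m + n) (x * y) (GrPiece.mul_mem_pow_add hx hy) :=
  DirectSum.of_mul_of _ _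

theorem grClass_add {n : ℕ} {x y : R} (hx : x ∈ I ^ n) (hy : y ∈ I ^ n) :
    grClass n x hx + grClass n y hy = grClass n (x + y) (Ideal.add_mem _ hx hy) :=
  ((DirectSum.of (GrPiece I) n).map_add _ _).symm

theorem grClass_congr {m n : ℕ} {x y : R} (hx : x ∈ I ^ m) (hy : y ∈ I ^ n) (h : m = n)
    (hxy : x = y) : grClass m x hx = grClass n y hy := by
  subst h; subst hxy; rfl

theorem grClass_eq_grClass_of_sub_mem {n : ℕ} {x y : R} (hx : x ∈ I ^ n) (hy : y ∈ I ^ n)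
    (h : x - y ∈ I ^ (n + 1)) : grClass n x hx = grClass n y hy :=
  congrArg _ (GrPiece.mk_eq_mk_iff.mpr h)

theorem grClass_eq_zero {n : ℕ} {x : R} (h : x ∈ I ^ (n + 1)) :
    grClass n x (Ideal.pow_le_pow_right n.le_succ h) = 0 := by
  refine (grClass_eq_grClass_of_sub_mem _ (Ideal.zero_mem _) (by rwa [sub_zero])).trans ?_
  exact (DirectSum.of (GrPiece I) n).map_zero

theorem grClass_pow {n : ℕ} {x : R} (hx : x ∈ I ^ n) (m : ℕ) :
    grClass n x hx ^ m = grClass (n * m) (x ^ m) (pow_mul I n m ▸ Ideal.pow_mem_pow hx m) := by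
  induction m with
  | zero =>
    rw [pow_zero]
    exact grClass_congr (m := 0) (by simp) _ rfl (pow_zero x).symm
  | succ m ih =>
    rw [pow_succ, ih, grClass_mul]
    exact grClass_congr _ _ rfl (pow_succ x m).symm

/-- The associated graded ring is generated by its degree zero part and the classes in degree one
of generators of the ideal. -/
theorem subring_eq_top_of_grClass_mem {s : Set R} (hs : I = Ideal.span s)
    (S : Subring (AssociatedGradedRing I)) (h0 : ∀ x hx, grClass 0 x hx ∈ S)
    (h1 : ∀ x ∈ s, ∀ hx, grClass 1 x hx ∈ S) : S = ⊤ := by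
  have hI : ∀ x (hx : x ∈ I ^ 1), grClass 1 x hx ∈ S := by
    have key : ∀ x (hx : x ∈ Ideal.span s), ∀ hx' : x ∈ I ^ 1, grClass 1 x hx' ∈ S := by
      intro x hx
      induction hx using Submodule.span_induction with
      | mem x hx => exact h1 x hx
      | zero =>
        intro _
        rw [grClass_eq_zero (Ideal.zero_mem _)]
        exact S.zero_mem
      | add x y hx hy hx1 hy1 =>
        intro _
        rw [← grClass_add ((pow_one I).ge (hs.ge hx)) ((pow_one I).ge (hs.ge hy))]
        exact S.add_mem (hx1 _) (hy1 _)
      | smul c x hx hx1 =>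
        intro _
        have hc : c ∈ I ^ 0 := by simp
        have hx' : x ∈ I ^ 1 := (pow_one I).ge (hs.ge hx)
        rw [← grClass_congr (GrPiece.mul_mem_pow_add hc hx') _ (zero_add 1) (smul_eq_mul c x).symm,
          ← grClass_mul hc hx']
        exact S.mul_mem (h0 _ _) (hx1 _)
    intro x hx
    exact key x (by rwa [← hs, ← pow_one I]) hx
  have hn : ∀ n x (hx : x ∈ I ^ n), grClass n x hx ∈ S := by
    intro n
    induction n with
    | zero => exact h0
    | succ n ih =>
      have key : ∀ x (hx : x ∈ I ^ n * I), ∀ hx' : x ∈ I ^ (n + 1),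
          grClass (n + 1) x hx' ∈ S := by
        intro x hx
        induction hx using Submodule.mul_induction_on' with
        | mem_mul_mem y hy z hz =>
          intro _
          have hz' : z ∈ I ^ 1 := by rwa [pow_one]
          rw [← grClass_mul hy hz']
          exact S.mul_mem (ih _ _) (hI _ _)
        | add y hy z hz hy1 hz1 =>
          intro _
          rw [← pow_succ] at hy hz
          rw [← grClass_add hy hz]
          exact S.add_mem (hy1 _) (hz1 _)
      intro x hx
      exact key x (by rwa [← pow_succ]) hx
  refine eq_top_iff.mpr fun g _ => ?_
  induction g using DirectSum.induction_on with
  | zero => exact S.zero_mem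
  | of n b =>
    obtain ⟨x, hx, rfl⟩ := GrPiece.exists_mk b
    exact hn n x hx
  | add p q hp hq => exact S.add_mem (hp trivial) (hq trivial)

/-- The canonical ring homomorphism from `R` onto the degree zero part `R / I` of the associated
graded ring. -/
def toGrPieceZero (I : Ideal R) : R →+* GrPiece I 0 where
  toFun x := GrPiece.mk 0 x (by simp)
  map_one' := rfl
  map_mul' _ _ := rfl
  map_zero' := rfl
  map_add' _ _ := rfl

/-- Let `R` be a `k`-algebra and `I` an ideal such that `k → R / I` is surjective. If `I` is
generated by a finite set, one of whose elements `x` has a class in `I / I²` that is a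
nonzerodivisor of the associated graded ring, while each of the others has a nilpotent class, then
the associated graded ring is Cohen–Macaulay, being finite and torsion-free over the polynomial
ring in the class of `x`. -/
theorem isCohenMacaulayRing_associatedGradedRing {k R : Type*} [Field k] [CommRing R] [Algebra k R]
    {I : Ideal R} {s : Set R} (hfin : s.Finite) (hs : I = Ideal.span s)
    (hk : ∀ y : R, ∃ c : k, y - algebraMap k R c ∈ I) {x : R} (hx : x ∈ s)
    (hreg : ∀ n, ∀ y ∈ I ^ n, x * y ∈ I ^ (n + 2) → y ∈ I ^ (n + 1))
    (hnil : ∀ y ∈ s, y ≠ x → ∃ N, 0 < N ∧ y ^ N ∈ I ^ (N + 1)) :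
    IsCohenMacaulayRing (AssociatedGradedRing I) := by
  have hsI : ∀ y ∈ s, y ∈ I ^ 1 := fun y hy => by
    rw [pow_one, hs]
    exact Ideal.subset_span hy
  set κ : k →+* GrPiece I 0 := (toGrPieceZero I).comp (algebraMap k R)
  set X := grClass 1 x (hsI x hx)
  have hX : X ∈ nonZeroDivisors (AssociatedGradedRing I) := by
    refine of_mem_nonZeroDivisors fun n b hb => ?_
    obtain ⟨y, hy, rfl⟩ := GrPiece.exists_mk b
    have h : x * y - 0 ∈ I ^ (1 + n + 1) :=
      (GrPiece.mk_eq_mk_iff (hx := GrPiece.mul_mem_pow_add (hsI x hx) hy)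
        (hy := Ideal.zero_mem _)).mp hb
    rw [sub_zero, show 1 + n + 1 = n + 2 by omega] at h
    exact GrPiece.mk_eq_mk_iff.mpr (by rw [sub_zero]; exact hreg n y hy h)
  let _ : Algebra (Polynomial k) (AssociatedGradedRing I) :=
    (Polynomial.eval₂RingHom ((DirectSum.ofZeroRingHom (GrPiece I)).comp κ) X).toAlgebra
  have hX' : algebraMap (Polynomial k) (AssociatedGradedRing I) Polynomial.X = X :=
    Polynomial.eval₂_X _ _
  have hC' (c : k) : algebraMap (Polynomial k) (AssociatedGradedRing I) (Polynomial.C c) =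
      grClass 0 (algebraMap k R c) (by simp) := Polynomial.eval₂_C _ _
  let G : Set (AssociatedGradedRing I) := {g | ∃ y, ∃ hy : y ∈ s, g = grClass 1 y (hsI y hy)}
  have hGfin : G.Finite := by
    have := hfin.to_subtype
    refine (Set.finite_range fun y : s => grClass 1 y.1 (hsI y.1 y.2)).subset ?_
    rintro _ ⟨y, hy, rfl⟩
    exact ⟨⟨y, hy⟩, rfl⟩
  have hGint : ∀ g ∈ G, IsIntegral (Polynomial k) g := by
    rintro _ ⟨y, hy, rfl⟩
    by_cases hyx : y = x
    · rw [grClass_congr _ (hsI x hx) rfl hyx]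
      have hXint : IsIntegral (Polynomial k) X := by
        rw [← hX']
        exact isIntegral_algebraMap
      exact hXint
    · obtain ⟨N, hN, hyN⟩ := hnil y hy hyx
      refine IsIntegral.of_pow hN ?_
      rw [grClass_pow, grClass_congr _ (Ideal.pow_le_pow_right N.le_succ hyN) (one_mul N) rfl,
        grClass_eq_zero hyN]
      exact isIntegral_zero
  have htop : Algebra.adjoin (Polynomial k) G = ⊤ := by
    have h := subring_eq_top_of_grClass_mem hs (Algebra.adjoin (Polynomial k) G).toSubring ?_ ?_
    · exact eq_top_iff.mpr fun g _ => h.ge (Subring.mem_top g)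
    · intro y hy
      obtain ⟨c, hc⟩ := hk y
      rw [grClass_eq_grClass_of_sub_mem hy (by simp) (by simpa using hc), ← hC']
      exact Subalgebra.algebraMap_mem _ _
    · intro y hy _
      exact Algebra.subset_adjoin ⟨y, hy, rfl⟩
  have : Module.Finite (Polynomial k) (AssociatedGradedRing I) := by
    have h := fg_adjoin_of_finite hGfin hGint
    rw [htop, Algebra.top_toSubmodule] at h
    exact ⟨h⟩
  refine isCohenMacaulayRing_of_finite_of_torsionFree (A := Polynomial k) ?_ ?_
  · rw [Polynomial.ringKrullDim_of_isNoetherianRing, ringKrullDim_eq_zero_of_field, zero_add]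
  · intro f hf
    exact eval₂_mem_nonZeroDivisors_of_degree_one κ hX hf

end AssociatedGraded

/-! ### Powers of the maximal ideal of a semigroup ring -/

/-- For the semigroup `H` generated by `T`, the set of elements of `H` having an expression as a
sum of at least `n` elements of `T`, that is, the elements of order at least `n`. -/
def orderAtLeast (T : Set ℕ) : ℕ → Set ℕ
  | 0 => AddSubmonoid.closure T
  | n + 1 => {s | ∃ g ∈ T, ∃ u ∈ orderAtLeast T n, s = g + u}

section orderAtLeast

variable {T : Set ℕ}

theorem add_mem_orderAtLeast {h s n : ℕ} (hh : h ∈ AddSubmonoid.closure T)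
    (hs : s ∈ orderAtLeast T n) : h + s ∈ orderAtLeast T n := by
  induction n generalizing s with
  | zero => exact add_mem hh hs
  | succ n ih =>
    obtain ⟨g, hg, u, hu, rfl⟩ := hs
    exact ⟨g, hg, h + u, ih hu, by omega⟩

theorem orderAtLeast_subset_closure (n : ℕ) :
    orderAtLeast T n ⊆ AddSubmonoid.closure T := by
  induction n with
  | zero => exact subset_rfl
  | succ n ih =>
    rintro _ ⟨g, hg, u, hu, rfl⟩
    exact add_mem (AddSubmonoid.subset_closure hg) (ih hu)

theorem mem_orderAtLeast_one {s : ℕ} (hs : s ∈ AddSubmonoid.closure T) (h0 : s ≠ 0) :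
    s ∈ orderAtLeast T 1 := by
  suffices s = 0 ∨ s ∈ orderAtLeast T 1 from this.resolve_left h0
  clear h0
  induction hs using AddSubmonoid.closure_induction with
  | mem g hg => exact Or.inr ⟨g, hg, 0, zero_mem (AddSubmonoid.closure T), rfl⟩
  | zero => exact Or.inl rfl
  | add x y hx hy hx1 hy1 =>
    rcases hy1 with rfl | hy1
    · exact hx1
    · exact Or.inr (add_mem_orderAtLeast hx hy1)

end orderAtLeast

section semigroupRing

variable {k : Type*} [Field k] {T : Set ℕ}

/-- The monomial `tˢ` of the semigroup ring, for `s` in the semigroup. -/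
noncomputable def tPow (k : Type*) [Field k] {H : AddSubmonoid ℕ} (s : ℕ) (hs : s ∈ H) :
    semigroupRing k H :=
  ⟨PowerSeries.X ^ s, fun n hn => by
    rw [PowerSeries.coeff_X_pow, if_neg fun h : n = s => hn (h ▸ hs)]⟩

theorem coe_tPow {H : AddSubmonoid ℕ} {s : ℕ} (hs : s ∈ H) :
    (tPow k s hs : k⟦X⟧) = PowerSeries.X ^ s := rfl

theorem mem_maximalIdeal_semigroupRing_iff {H : AddSubmonoid ℕ} {f : semigroupRing k H} :
    f ∈ IsLocalRing.maximalIdeal (semigroupRing k H) ↔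
      PowerSeries.constantCoeff (f : k⟦X⟧) = 0 := by
  rw [IsLocalRing.mem_maximalIdeal, mem_nonunits_iff, isUnit_semigroupRing_iff, not_not]

/-- A series supported in orders at least `n + 1` is a combination of the monomials `t ^ g`, for
`g` in the finite generating set, with coefficients supported in orders at least `n`: distribute
the terms `c tˢ` according to a chosen generator `g` with `s - g` of order at least `n`. -/
theorem exists_eq_sum_tPow_mul [Fintype T] {n : ℕ}
    {f : semigroupRing k (AddSubmonoid.closure T)}
    (hf : ∀ s ∉ orderAtLeast T (n + 1), PowerSeries.coeff s (f : k⟦X⟧) = 0) :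
    ∃ F : T → semigroupRing k (AddSubmonoid.closure T),
      (∀ g, ∀ s ∉ orderAtLeast T n, PowerSeries.coeff s (F g : k⟦X⟧) = 0) ∧
      f = ∑ g, tPow k g.1 (AddSubmonoid.subset_closure g.2) * F g := by
  classical
  have hex : ∀ s, ∃ g, s ∈ orderAtLeast T (n + 1) →
      g ∈ T ∧ ∃ u ∈ orderAtLeast T n, s = g + u := by
    intro s
    by_cases h : s ∈ orderAtLeast T (n + 1)
    · obtain ⟨g, hg, hu⟩ := h
      exact ⟨g, fun _ => ⟨hg, hu⟩⟩
    · exact ⟨0, fun h' => absurd h' h⟩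
  choose γ hγ using hex
  let F (g : ℕ) : k⟦X⟧ := PowerSeries.mk fun u =>
    if g + u ∈ orderAtLeast T (n + 1) ∧ γ (g + u) = g then PowerSeries.coeff (g + u) (f : k⟦X⟧)
    else 0
  have hF : ∀ g, ∀ s ∉ orderAtLeast T n, PowerSeries.coeff s (F g) = 0 := by
    intro g s hs
    rw [PowerSeries.coeff_mk, if_neg]
    rintro ⟨h1, h2⟩
    obtain ⟨-, u, hu, h3⟩ := hγ _ h1
    obtain rfl : s = u := by omega
    exact hs hu
  refine ⟨fun g => ⟨F g, fun s hs => hF g s fun h => hs (orderAtLeast_subset_closure n h)⟩,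
    fun g => hF g, Subtype.ext (PowerSeries.ext fun s => ?_)⟩
  simp only [AddSubmonoidClass.coe_finsetSum, MulMemClass.coe_mul, tPow, map_sum,
    PowerSeries.coeff_X_pow_mul']
  have hterm (g : T) : (if (g : ℕ) ≤ s then PowerSeries.coeff (s - g) (F g) else 0) =
      if s ∈ orderAtLeast T (n + 1) ∧ γ s = g then PowerSeries.coeff s (f : k⟦X⟧) else 0 := by
    split_ifs with h1 h2 h2
    · rw [PowerSeries.coeff_mk, Nat.add_sub_cancel' h1, if_pos h2]
    · rw [PowerSeries.coeff_mk, Nat.add_sub_cancel' h1, if_neg h2]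
    · obtain ⟨-, u, -, h3⟩ := hγ s h2.1
      omega
    · rfl
  simp only [hterm]
  by_cases hs : s ∈ orderAtLeast T (n + 1)
  · rw [Finset.sum_eq_single_of_mem ⟨γ s, (hγ s hs).1⟩ (Finset.mem_univ _)]
    · rw [if_pos ⟨hs, rfl⟩]
    · intro g _ hg
      rw [if_neg]
      rintro ⟨-, h⟩
      exact hg (Subtype.ext h.symm)
  · rw [hf s hs, Finset.sum_eq_zero]
    intro g _
    rw [if_neg fun h => hs h.1]

theorem coeff_eq_zero_of_mem_maximalIdeal
    {f : semigroupRing k (AddSubmonoid.closure T)}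
    (hf : f ∈ IsLocalRing.maximalIdeal (semigroupRing k (AddSubmonoid.closure T))) :
    ∀ s ∉ orderAtLeast T 1, PowerSeries.coeff s (f : k⟦X⟧) = 0 := by
  intro s hs
  by_cases h0 : s = 0
  · rw [h0, PowerSeries.coeff_zero_eq_constantCoeff_apply]
    exact mem_maximalIdeal_semigroupRing_iff.mp hf
  · exact f.2 s fun h => hs (mem_orderAtLeast_one h h0)

theorem tPow_mem_maximalIdeal (h0 : 0 ∉ T) {g : ℕ} (hg : g ∈ T) :
    tPow k g (AddSubmonoid.subset_closure hg) ∈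
      IsLocalRing.maximalIdeal (semigroupRing k (AddSubmonoid.closure T)) := by
  rw [mem_maximalIdeal_semigroupRing_iff]
  have : g ≠ 0 := fun h => h0 (h ▸ hg)
  simp [tPow, this]

/-- The `n`-th power of the maximal ideal of the semigroup ring consists of the series supported in
the elements of order at least `n`. -/
theorem mem_maximalIdeal_pow_iff (hT : T.Finite) (h0 : 0 ∉ T) (n : ℕ)
    (f : semigroupRing k (AddSubmonoid.closure T)) :
    f ∈ IsLocalRing.maximalIdeal (semigroupRing k (AddSubmonoid.closure T)) ^ n ↔
      ∀ s ∉ orderAtLeast T n, PowerSeries.coeff s (f : k⟦X⟧) = 0 := by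
  have := hT.fintype
  induction n generalizing f with
  | zero =>
    rw [pow_zero, Ideal.one_eq_top]
    exact iff_of_true trivial f.2
  | succ n ih =>
    constructor
    · intro hf
      rw [pow_succ'] at hf
      induction hf using Submodule.mul_induction_on' with
      | mem_mul_mem x hx y hy =>
        intro s hs
        rw [MulMemClass.coe_mul, PowerSeries.coeff_mul]
        refine Finset.sum_eq_zero fun p hp => ?_
        rw [Finset.HasAntidiagonal.mem_antidiagonal] at hp
        by_cases h1 : p.1 ∈ orderAtLeast T 1
        · by_cases h2 : p.2 ∈ orderAtLeast T n
          · obtain ⟨g, hg, u, hu, h⟩ := h1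
            exact absurd ⟨g, hg, u + p.2, add_mem_orderAtLeast hu h2, by omega⟩ hs
          · rw [(ih y).mp hy _ h2, mul_zero]
        · rw [coeff_eq_zero_of_mem_maximalIdeal hx _ h1, zero_mul]
      | add x hx y hy hx1 hy1 =>
        intro s hs
        rw [AddMemClass.coe_add, map_add, hx1 s hs, hy1 s hs, add_zero]
    · intro hf
      obtain ⟨F, hF, rfl⟩ := exists_eq_sum_tPow_mul hf
      refine Ideal.sum_mem _ fun g _ => ?_
      rw [pow_succ']
      exact Ideal.mul_mem_mul (tPow_mem_maximalIdeal h0 g.2) ((ih _).mpr (hF g))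

theorem maximalIdeal_eq_span_range_tPow (hT : T.Finite) (h0 : 0 ∉ T) :
    IsLocalRing.maximalIdeal (semigroupRing k (AddSubmonoid.closure T)) =
      Ideal.span (Set.range fun g : T => tPow k g.1 (AddSubmonoid.subset_closure g.2)) := by
  have := hT.fintype
  refine le_antisymm (fun f hf => ?_) (Ideal.span_le.mpr ?_)
  · obtain ⟨F, -, rfl⟩ := exists_eq_sum_tPow_mul (coeff_eq_zero_of_mem_maximalIdeal hf)
    exact Ideal.sum_mem _ fun g _ => Ideal.mul_mem_right _ _ (Ideal.subset_span ⟨g, rfl⟩)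
  · rintro _ ⟨g, rfl⟩
    exact tPow_mem_maximalIdeal h0 g.2

/-- Let `g` be the least element of the generating set `T`. If adding `g` to an element of the
semigroup raises its order by exactly one, then the associated graded ring of the semigroup ring is
Cohen–Macaulay. The initial forms of the other monomial generators `t ^ h` are nilpotent because
`(t ^ h) ^ g = (t ^ g) ^ h` and `g < h`. -/
theorem isCohenMacaulayRing_of_orderAtLeast (hT : T.Finite) (h0 : 0 ∉ T) {g : ℕ} (hg : g ∈ T)
    (hmin : ∀ h ∈ T, g ≤ h)
    (hord : ∀ n, ∀ s ∈ orderAtLeast T n, g + s ∈ orderAtLeast T (n + 2) →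
      s ∈ orderAtLeast T (n + 1)) :
    IsCohenMacaulayRing (AssociatedGradedRing (IsLocalRing.maximalIdeal
      (semigroupRing k (AddSubmonoid.closure T)))) := by
  have := hT.to_subtype
  refine isCohenMacaulayRing_associatedGradedRing (k := k) (Set.finite_range _)
    (maximalIdeal_eq_span_range_tPow hT h0) (fun f => ?_) ⟨⟨g, hg⟩, rfl⟩ ?_ ?_
  · refine ⟨PowerSeries.constantCoeff (f : k⟦X⟧), ?_⟩
    rw [mem_maximalIdeal_semigroupRing_iff]
    simp
  · intro n f hf hgf
    rw [mem_maximalIdeal_pow_iff hT h0] at hf hgf ⊢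
    intro s hs
    by_cases hsn : s ∈ orderAtLeast T n
    · have h := hgf (g + s) fun h => hs (hord n s hsn h)
      rwa [MulMemClass.coe_mul, coe_tPow, PowerSeries.coeff_X_pow_mul', if_pos (Nat.le_add_right g s),
        Nat.add_sub_cancel_left] at h
    · exact hf s hsn
  · rintro _ ⟨⟨h, hh⟩, rfl⟩ hne
    have hlt : g < h := by
      refine lt_of_le_of_ne (hmin h hh) ?_
      rintro rfl
      exact hne rfl
    refine ⟨g, Nat.pos_of_ne_zero fun h => h0 (h ▸ hg), ?_⟩
    have heq : tPow k h (AddSubmonoid.subset_closure hh) ^ g =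
        tPow k g (AddSubmonoid.subset_closure hg) ^ h :=
      Subtype.ext (by simp only [SubmonoidClass.coe_pow, coe_tPow, ← pow_mul, mul_comm])
    rw [heq]
    exact Ideal.pow_le_pow_right hlt (Ideal.pow_mem_pow (tPow_mem_maximalIdeal h0 hg) h)

end semigroupRing

/-! ### The semigroup generated by `a`, `a + 1`, `a + d` -/

theorem mem_closure_triple_iff {a d s : ℕ} : s ∈ AddSubmonoid.closure {a, a + 1, a + d} ↔
    ∃ N y z, y + z ≤ N ∧ s = N * a + (y + d * z) := by
  constructor
  · intro hs
    induction hs using AddSubmonoid.closure_induction with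
    | mem x hx =>
      rcases hx with rfl | rfl | rfl
      · exact ⟨1, 0, 0, by omega, by ring⟩
      · exact ⟨1, 1, 0, by omega, by ring⟩
      · exact ⟨1, 0, 1, by omega, by ring⟩
    | zero => exact ⟨0, 0, 0, by omega, by ring⟩
    | add s t _ _ hs ht =>
      obtain ⟨N, y, z, h, rfl⟩ := hs
      obtain ⟨N', y', z', h', rfl⟩ := ht
      exact ⟨N + N', y + y', z + z', by omega, by ring⟩
  · rintro ⟨N, y, z, h, rfl⟩
    obtain ⟨x, rfl⟩ := Nat.exists_eq_add_of_le h
    have h1 : a ∈ AddSubmonoid.closure {a, a + 1, a + d} := AddSubmonoid.subset_closure (by simp)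
    have h2 : a + 1 ∈ AddSubmonoid.closure {a, a + 1, a + d} :=
      AddSubmonoid.subset_closure (by simp)
    have h3 : a + d ∈ AddSubmonoid.closure {a, a + 1, a + d} :=
      AddSubmonoid.subset_closure (by simp)
    have := add_mem (add_mem (nsmul_mem h1 x) (nsmul_mem h2 y)) (nsmul_mem h3 z)
    simp only [smul_eq_mul] at this
    convert this using 1
    ring

/-- A sum of `N` elements of `{a, a + 1, a + d}` has the form `N * a + (y + d * z)` with
`y + z ≤ N`. -/
theorem mem_orderAtLeast_triple_iff {a d s n : ℕ} : s ∈ orderAtLeast {a, a + 1, a + d} n ↔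
    ∃ N y z, n ≤ N ∧ y + z ≤ N ∧ s = N * a + (y + d * z) := by
  induction n generalizing s with
  | zero => exact mem_closure_triple_iff.trans (by simp)
  | succ n ih =>
    constructor
    · rintro ⟨g, hg, u, hu, rfl⟩
      obtain ⟨N, y, z, hN, h, rfl⟩ := ih.mp hu
      rcases hg with rfl | rfl | rfl
      · exact ⟨N + 1, y, z, by omega, by omega, by ring⟩
      · exact ⟨N + 1, y + 1, z, by omega, by omega, by ring⟩
      · exact ⟨N + 1, y, z + 1, by omega, by omega, by ring⟩
    · rintro ⟨N, y, z, hN, h, rfl⟩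
      obtain ⟨N, rfl⟩ : ∃ M, N = M + 1 := ⟨N - 1, by omega⟩
      rcases Nat.eq_zero_or_pos y with rfl | hy
      · rcases Nat.eq_zero_or_pos z with rfl | hz
        · exact ⟨a, by simp, _, ih.mpr ⟨N, 0, 0, by omega, by omega, rfl⟩, by ring⟩
        · obtain ⟨z, rfl⟩ : ∃ w, z = w + 1 := ⟨z - 1, by omega⟩
          exact ⟨a + d, by simp, _, ih.mpr ⟨N, 0, z, by omega, by omega, rfl⟩, by ring⟩
      · obtain ⟨y, rfl⟩ : ∃ w, y = w + 1 := ⟨y - 1, by omega⟩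
        exact ⟨a + 1, by simp, _, ih.mpr ⟨N, y, z, by omega, by omega, rfl⟩, by ring⟩

/-- The least value of `y + z` over all expressions `j = y + d * z` is `j / d + j % d`. -/
theorem div_add_mod_le {d : ℕ} (hd : 0 < d) (y z : ℕ) :
    (y + d * z) / d + (y + d * z) % d ≤ y + z := by
  rw [Nat.add_mul_div_left _ _ hd, Nat.add_mul_mod_self_left]
  have h1 := Nat.mod_add_div y d
  have h2 := Nat.le_mul_of_pos_left (y / d) hd
  omega

/-- Adding `a = d * q + r` lowers `j / d + j % d` by at most one: if there is no carry the value
goes up by `q + r`, and otherwise it changes by `q + r + 1 - d`, which is at least `-1`. -/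
theorem div_add_mod_le_add_one {d q r : ℕ} (hd : 0 < d) (hr : r < d) (hqr : d - 2 ≤ q + r)
    (j : ℕ) : j / d + j % d ≤ (j + (d * q + r)) / d + (j + (d * q + r)) % d + 1 := by
  have hv := Nat.mod_lt j hd
  have hj := Nat.mod_add_div j d
  set u := j / d
  set v := j % d
  by_cases hc : v + r < d
  · have h : j + (d * q + r) = (v + r) + d * (u + q) := by rw [← hj]; ring
    rw [h, Nat.add_mul_div_left _ _ hd, Nat.add_mul_mod_self_left, Nat.mod_eq_of_lt hc,
      Nat.div_eq_of_lt hc]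
    omega
  · obtain ⟨w, hw⟩ := Nat.exists_eq_add_of_le (not_lt.mp hc)
    have h : j + (d * q + r) = w + d * (u + q + 1) := by
      rw [← hj]
      linear_combination hw
    have hwd : w < d := by omega
    rw [h, Nat.add_mul_div_left _ _ hd, Nat.add_mul_mod_self_left, Nat.mod_eq_of_lt hwd,
      Nat.div_eq_of_lt hwd]
    omega

theorem div_add_mod_le_add {a d q r : ℕ} (hd : 0 < d) (haqr : a = d * q + r) (hr : r < d)
    (hqr : d - 2 ≤ q + r) (j m : ℕ) :
    j / d + j % d ≤ (j + m * a) / d + (j + m * a) % d + m := by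
  induction m with
  | zero => simp
  | succ m ih =>
    have h := div_add_mod_le_add_one hd hr hqr (j + m * a)
    rw [← haqr, show j + m * a + a = j + (m + 1) * a by ring] at h
    omega

/-- Adding `a` raises the order of an element of the semigroup by exactly one. -/
theorem mem_orderAtLeast_succ_of_add_mem {a d q r : ℕ} (hd : 0 < d)
    (haqr : a = d * q + r) (hr : r < d) (hqr : d - 2 ≤ q + r) {n s : ℕ}
    (hs : s ∈ orderAtLeast {a, a + 1, a + d} n)
    (hsa : a + s ∈ orderAtLeast {a, a + 1, a + d} (n + 2)) :
    s ∈ orderAtLeast {a, a + 1, a + d} (n + 1) := by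
  obtain ⟨N', y', z', hN', h', hs'⟩ := mem_orderAtLeast_triple_iff.mp hs
  obtain ⟨N, y, z, hN, h, hsN⟩ := mem_orderAtLeast_triple_iff.mp hsa
  by_cases hle : n + 1 ≤ N'
  · exact mem_orderAtLeast_triple_iff.mpr ⟨N', y', z', hle, h', hs'⟩
  obtain ⟨m, rfl⟩ : ∃ m, N = N' + m + 1 := ⟨N - N' - 1, by omega⟩
  set j := y + d * z with hj
  have hjm : y' + d * z' = j + m * a := by
    have : a + (N' * a + (y' + d * z')) = (N' + m + 1) * a + j := by rw [← hs', hsN]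
    linarith
  have h1 := div_add_mod_le_add hd haqr hr hqr j m
  have h2 := div_add_mod_le hd y' z'
  rw [hjm] at h2
  -- The minimal expression of `j` has at most `N' + m` terms, which makes `s` a sum of `N' + m`
  -- generators.
  refine mem_orderAtLeast_triple_iff.mpr ⟨N' + m, j % d, j / d, by omega, by omega, ?_⟩
  rw [Nat.mod_add_div, hs', hjm]
  ring

theorem mainTheorem7 (k : Type*) [Field k] (a d q r : ℕ) (hd : 2 ≤ d) (hda : d < a)
    (hgcd : Nat.gcd a d = 1) (haqr : a = d * q + r) (hr1 : 1 ≤ r) (hr2 : r ≤ d - 1)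
    (hqr : d - 2 ≤ q + r) :
    IsCohenMacaulayRing (AssociatedGradedRing (IsLocalRing.maximalIdeal
      (semigroupRing k (AddSubmonoid.closure {a, a + 1, a + d})))) := by
  refine isCohenMacaulayRing_of_orderAtLeast (g := a) (Set.toFinite _) ?_ (by simp) ?_ ?_
  · simp only [Set.mem_insert_iff, Set.mem_singleton_iff]
    omega
  · simp only [Set.mem_insert_iff, Set.mem_singleton_iff]
    omega
  · exact fun n s hs hsa => mem_orderAtLeast_succ_of_add_mem (by omega) haqr (by omega)
      hqr hs hsa
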